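/- Let $\Omega\subset\mathbb{R}^3$ be a bounded open set with $C^1$ boundary, and let $S^3$ be the space of symmetric real $3\times 3$ matrices with the inner product $(s,t)=\sum_{i,j}s_{ij}t_{ij}$. For $x\in\Omega$ let $\mathcal C(x):S^3\to S^3$, $\epsilon(x):\mathbb{R}^3\to\mathbb{R}^3$ and $e(x):S^3\to\mathbb{R}^3$ be linear maps whose entries are bounded measurable functions of $x$. Assume that $\mathcal C(x)$ and $\epsilon(x)$ are symmetric for a.e. $x\in\Omega$ and positive definite uniformly with respect to a.e. $x\in\Omega$, that is, for some $c_0>0$ and a.e. $x\in\Omega$, $(\mathcal C(x)s,s)\ge c_0|s|^2$ for all $s\in S^3$ and $(\epsilon(x)\xi,\xi)\ge c_0|\xi|^2$ for all $\xi\in\mathbb{R}^3$. For $u\in W^{1,2}_0(\Omega,\mathbb{R}^3)$ and $\phi\in W^{1,2}_0(\Omega)$ write $\varepsilon(u)=\tfrac12(\nabla u+(\nabla u)^T)$ and $E=-\nabla\phi$. Here $W^{1,2}_0$ is the closure of $C_c^\infty(\Omega)$ in $W^{1,2}(\Omega)$, and $W^{-1,2}$ is the dual space of $W^{1,2}_0$,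 with pairing $\langle\cdot,\cdot\rangle$ and norm $\|\cdot\|_{-1,2}$. Given $(r,P)\in L^2(\Omega,S^3\times\mathbb{R}^3)$ and $(b,q)\in W^{-1,2}(\Omega,\mathbb{R}^3\times\mathbb{R})$, the pair $(u,\phi)\in W^{1,2}_0(\Omega,\mathbb{R}^3\times\mathbb{R})$ is called a weak solution of the piezoelectric Dirichlet problem $$-\operatorname{div}\sigma=b,\qquad \operatorname{div}D=q,\qquad \sigma=\mathcal C(\varepsilon(u)-r)-e^TE,\qquad D=e(\varepsilon(u)-r)+\epsilon E+P\quad\text{in }\Omega,\qquad u=0,\ \phi=0\quad\text{on }\partial\Omega,$$ if $\int_\Omega(\sigma,\varepsilon(v))\,dx=\langle b,v\rangle$ for all $v\in W^{1,2}_0(\Omega,\mathbb{R}^3)$ and $-\int_\Omega(D,\nabla\psi)\,dx=\langle q,\psi\rangle$ for all $\psi\in W^{1,2}_0(\Omega)$. Then there is a constant $c>0$, independent of $r,P,b,q$, such that for all $(r,P)\in L^2(\Omega,S^3\times\mathbb{R}^3)$ and $(b,q)\in W^{-1,2}(\Omega,\mathbb{R}^3\times\mathbb{R})$ this problem has a unique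 weak solution $(u,\phi)\in W^{1,2}_0(\Omega,\mathbb{R}^3\times\mathbb{R})$, and this solution satisfies $$\|u\|_{1,2}+\|\phi\|_{1,2}\le c\,\big(\|r\|_{2}+\|P\|_{2}+\|b\|_{-1,2}+\|q\|_{-1,2}\big).$$ -/

import Mathlib

open MeasureTheory Set
open scoped ENNReal ContDiff Distributions InnerProductSpace

noncomputable section

namespace Piezo

/-- Euclidean space `ℝ³`. -/
abbrev E3 : Type := EuclideanSpace ℝ (Fin 3)

/-- The space `S³` of symmetric `3 × 3` matrices, with the inner product
`(s, t) = ∑ i j, s i j * t i j` and its (Frobenius) norm. -/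
def S3 : Submodule ℝ (EuclideanSpace ℝ (Fin 3 × Fin 3)) where
  carrier := {s | ∀ i j, s (i, j) = s (j, i)}
  add_mem' := by
    intro s t hs ht i j
    simp only [PiLp.add_apply]
    rw [hs i j, ht i j]
  zero_mem' := by
    intro i j
    simp
  smul_mem' := by
    intro a s hs i j
    simp only [PiLp.smul_apply]
    rw [hs i j]

instance instCompleteSpaceS3 : CompleteSpace S3 := FiniteDimensional.complete ℝ S3

/-- The open set `Ω` has a `C¹` boundary: near each boundary point it is the region `ρ < 0`
of a `C¹` function `ρ` with non-vanishing differential at that point. -/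
def HasC1Boundary (Ω : TopologicalSpace.Opens E3) : Prop :=
  ∀ x ∈ frontier (Ω : Set E3), ∃ V : Set E3, IsOpen V ∧ x ∈ V ∧
    ∃ ρ : E3 → ℝ, ContDiffOn ℝ 1 ρ V ∧ fderiv ℝ ρ x ≠ 0 ∧
      (Ω : Set E3) ∩ V = {y | y ∈ V ∧ ρ y < 0}

section Sobolev

variable (Ω : TopologicalSpace.Opens E3) (F : Type) [NormedAddCommGroup F]
  [InnerProductSpace ℝ F]

/-- The Lebesgue measure on `Ω`. -/
abbrev vol : Measure E3 := volume.restrict (Ω : Set E3)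

/-- `L²(Ω, F)`. -/
abbrev L2 : Type := Lp F 2 (vol Ω)

/-- The classical partial derivative `∂ₖ f (x)`. -/
def partialDeriv (f : E3 → ℝ) (k : Fin 3) (x : E3) : ℝ :=
  fderiv ℝ f x (EuclideanSpace.single k 1)

variable {F} in
/-- `g` is the weak partial derivative `∂ₖ u` on `Ω`:
`∫_Ω (∂ₖ η) u = - ∫_Ω η g` for all `η ∈ C_c^∞(Ω)`. -/
def IsWeakPartialDeriv (k : Fin 3) (u g : E3 → F) : Prop :=
  ∀ η : 𝓓(Ω, ℝ), ∫ x in (Ω : Set E3), partialDeriv η k x • u x =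
    - ∫ x in (Ω : Set E3), η x • g x

variable {Ω F} in
lemma integrable_testFunction_smul (η : 𝓓(Ω, ℝ)) (u : L2 Ω F) :
    Integrable (fun x => η x • u x) (vol Ω) := by
  have h : MemLp η 2 (vol Ω) :=
    (η.continuous.memLp_of_hasCompactSupport η.hasCompactSupport (μ := volume)).restrict _
  exact memLp_one_iff_integrable.1 ((Lp.memLp u).smul h)

variable {Ω F} in
lemma integrable_partialDeriv_smul (η : 𝓓(Ω, ℝ)) (k : Fin 3) (u : L2 Ω F) :
    Integrable (fun x => partialDeriv η k x • u x) (vol Ω) := by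
  have hc : Continuous (fun x => partialDeriv η k x) :=
    (η.contDiff.continuous_fderiv (by simp)).clm_apply continuous_const
  have hs : HasCompactSupport (fun x => partialDeriv η k x) :=
    η.hasCompactSupport.fderiv_apply ℝ _
  have h : MemLp (fun x => partialDeriv η k x) 2 (vol Ω) :=
    (hc.memLp_of_hasCompactSupport hs (μ := volume)).restrict _
  exact memLp_one_iff_integrable.1 ((Lp.memLp u).smul h)

/-- The Hilbert space of all `(u, (g₁, g₂, g₃))` with `u, gₖ ∈ L²(Ω, F)` and the norm
`(‖u‖² + ∑ k, ‖gₖ‖²)^(1/2)`. -/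
abbrev Jet : Type := WithLp 2 (L2 Ω F × PiLp 2 (fun _ : Fin 3 => L2 Ω F))

/-- The Sobolev space `W^{1,2}(Ω, F)`: the functions `u ∈ L²(Ω, F)` whose weak partial
derivatives lie in `L²(Ω, F)`. An element is stored with these derivatives (which `u`
determines as elements of `L²(Ω, F)`); the norm is `(‖u‖₂² + ∑ k, ‖∂ₖ u‖₂²)^(1/2)`. -/
def W12 : Submodule ℝ (Jet Ω F) where
  carrier := {U | ∀ k, IsWeakPartialDeriv Ω k U.fst (U.snd k)}
  add_mem' := by
    intro U V hU hV k η
    have h1 : ∫ x in (Ω : Set E3), partialDeriv η k x • ((U.fst + V.fst : L2 Ω F) : E3 → F) x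
        = ∫ x in (Ω : Set E3), (partialDeriv η k x • U.fst x + partialDeriv η k x • V.fst x) := by
      refine integral_congr_ae ?_
      filter_upwards [Lp.coeFn_add U.fst V.fst] with x hx
      rw [hx, Pi.add_apply, smul_add]
    have h2 : ∫ x in (Ω : Set E3), η x • ((U.snd k + V.snd k : L2 Ω F) : E3 → F) x
        = ∫ x in (Ω : Set E3), (η x • U.snd k x + η x • V.snd k x) := by
      refine integral_congr_ae ?_
      filter_upwards [Lp.coeFn_add (U.snd k) (V.snd k)] with x hx
      rw [hx, Pi.add_apply, smul_add]
    rw [integral_add (integrable_partialDeriv_smul η k _)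
      (integrable_partialDeriv_smul η k _)] at h1
    rw [integral_add (integrable_testFunction_smul η _)
      (integrable_testFunction_smul η _)] at h2
    change ∫ x in (Ω : Set E3), partialDeriv η k x • ((U.fst + V.fst : L2 Ω F) : E3 → F) x
      = - ∫ x in (Ω : Set E3), η x • ((U.snd k + V.snd k : L2 Ω F) : E3 → F) x
    rw [h1, h2, hU k η, hV k η, neg_add]
  zero_mem' := by
    intro k η
    have h1 : ∫ x in (Ω : Set E3), partialDeriv η k x • ((0 : L2 Ω F) : E3 → F) x = 0 := by
      refine integral_eq_zero_of_ae ?_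
      filter_upwards [Lp.coeFn_zero F 2 (vol Ω)] with x hx
      rw [hx]; simp
    have h2 : ∫ x in (Ω : Set E3), η x • ((0 : L2 Ω F) : E3 → F) x = 0 := by
      refine integral_eq_zero_of_ae ?_
      filter_upwards [Lp.coeFn_zero F 2 (vol Ω)] with x hx
      rw [hx]; simp
    change ∫ x in (Ω : Set E3), partialDeriv η k x • ((0 : L2 Ω F) : E3 → F) x
      = - ∫ x in (Ω : Set E3), η x • ((0 : L2 Ω F) : E3 → F) x
    rw [h1, h2, neg_zero]
  smul_mem' := by
    intro a U hU k η
    have h1 : ∫ x in (Ω : Set E3), partialDeriv η k x • ((a • U.fst : L2 Ω F) : E3 → F) x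
        = a • ∫ x in (Ω : Set E3), partialDeriv η k x • U.fst x := by
      rw [← integral_smul]
      refine integral_congr_ae ?_
      filter_upwards [Lp.coeFn_smul a U.fst] with x hx
      rw [hx, Pi.smul_apply, smul_comm]
    have h2 : ∫ x in (Ω : Set E3), η x • ((a • U.snd k : L2 Ω F) : E3 → F) x
        = a • ∫ x in (Ω : Set E3), η x • U.snd k x := by
      rw [← integral_smul]
      refine integral_congr_ae ?_
      filter_upwards [Lp.coeFn_smul a (U.snd k)] with x hx
      rw [hx, Pi.smul_apply, smul_comm]
    change ∫ x in (Ω : Set E3), partialDeriv η k x • ((a • U.fst : L2 Ω F) : E3 → F) x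
      = - ∫ x in (Ω : Set E3), η x • ((a • U.snd k : L2 Ω F) : E3 → F) x
    rw [h1, h2, hU k η, smul_neg]

/-- The subspace `C_c^∞(Ω, F)` of `W^{1,2}(Ω, F)`. -/
def testSubspace : Submodule ℝ (W12 Ω F) where
  carrier := {U | ∃ f : 𝓓(Ω, F), U.1.fst =ᵐ[vol Ω] f}
  add_mem' := by
    rintro U V ⟨f, hf⟩ ⟨g, hg⟩
    refine ⟨f + g, ?_⟩
    filter_upwards [Lp.coeFn_add U.1.fst V.1.fst, hf, hg] with x hx h1 h2
    change ((U.1.fst + V.1.fst : L2 Ω F) : E3 → F) x = f x + g x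
    rw [hx, Pi.add_apply, h1, h2]
  zero_mem' := ⟨0, Lp.coeFn_zero F 2 (vol Ω)⟩
  smul_mem' := by
    rintro a U ⟨f, hf⟩
    refine ⟨a • f, ?_⟩
    filter_upwards [Lp.coeFn_smul a U.1.fst, hf] with x hx h1
    change ((a • U.1.fst : L2 Ω F) : E3 → F) x = a • f x
    rw [hx, Pi.smul_apply, h1]

/-- `W^{1,2}_0(Ω, F)`: the closure of `C_c^∞(Ω, F)` in `W^{1,2}(Ω, F)`, with the norm
of `W^{1,2}(Ω, F)`. -/
def W012 : Submodule ℝ (W12 Ω F) := (testSubspace Ω F).topologicalClosure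

/-- `W^{-1,2}(Ω, F)`: the dual space of `W^{1,2}_0(Ω, F)`, with the operator norm. -/
abbrev Wm12 : Type := StrongDual ℝ (W012 Ω F)

variable {Ω F} in
/-- The weak partial derivative `∂ₖ u ∈ L²(Ω, F)` of `u ∈ W^{1,2}_0(Ω, F)`. -/
def wderiv (u : W012 Ω F) (k : Fin 3) : L2 Ω F := u.1.1.snd k

end Sobolev

variable {Ω : TopologicalSpace.Opens E3}

/-- The linearized strain `ε(u) = (∇u + (∇u)ᵀ) / 2`. -/
def strain (u : W012 Ω E3) (x : E3) : S3 :=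
  ⟨WithLp.toLp 2 fun p => (wderiv u p.2 x p.1 + wderiv u p.1 x p.2) / 2, by
    intro i j
    change (wderiv u j x i + wderiv u i x j) / 2 = (wderiv u i x j + wderiv u j x i) / 2
    rw [add_comm]⟩

/-- The gradient `∇φ` of a scalar function. -/
def grad (φ : W012 Ω ℝ) (x : E3) : E3 := WithLp.toLp 2 fun k => wderiv φ k x

/-- The electric field `E(φ) = -∇φ`. -/
def electricField (φ : W012 Ω ℝ) (x : E3) : E3 := - grad φ x

/-- The stress `σ = C (ε(u) - r) - eᵀ E(φ)`. -/
def stress (C : E3 → S3 →L[ℝ] S3) (e : E3 → S3 →L[ℝ] E3) (r : L2 Ω S3)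
    (u : W012 Ω E3) (φ : W012 Ω ℝ) (x : E3) : S3 :=
  C x (strain u x - r x) - (e x).adjoint (electricField φ x)

/-- The electric displacement `D = e (ε(u) - r) + ϵ E(φ) + P`. -/
def displacement (ϵ : E3 → E3 →L[ℝ] E3) (e : E3 → S3 →L[ℝ] E3) (r : L2 Ω S3) (P : L2 Ω E3)
    (u : W012 Ω E3) (φ : W012 Ω ℝ) (x : E3) : E3 :=
  e x (strain u x - r x) + ϵ x (electricField φ x) + P x

/-- `(u, φ) ∈ W^{1,2}_0(Ω, ℝ³ × ℝ)` is a weak solution of `-div σ = b`, `div D = q` in `Ω`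
with `u = 0`, `φ = 0` on `∂Ω`: the equations hold when tested with all `v ∈ W^{1,2}_0(Ω, ℝ³)`
and all `ψ ∈ W^{1,2}_0(Ω)`. -/
def IsWeakSolution (C : E3 → S3 →L[ℝ] S3) (ϵ : E3 → E3 →L[ℝ] E3) (e : E3 → S3 →L[ℝ] E3)
    (r : L2 Ω S3) (P : L2 Ω E3) (b : Wm12 Ω E3) (q : Wm12 Ω ℝ)
    (U : W012 Ω E3 × W012 Ω ℝ) : Prop :=
  (∀ v : W012 Ω E3, ∫ x in (Ω : Set E3), ⟪stress C e r U.1 U.2 x, strain v x⟫_ℝ = b v) ∧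
  (∀ ψ : W012 Ω ℝ, - ∫ x in (Ω : Set E3), ⟪displacement ϵ e r P U.1 U.2 x, grad ψ x⟫_ℝ = q ψ)

/-- The field `A` of linear maps is symmetric for a.e. `x ∈ Ω`, and positive definite
uniformly with respect to a.e. `x ∈ Ω`. -/
def SymmUniformlyPosDef {V : Type} [NormedAddCommGroup V] [InnerProductSpace ℝ V]
    (Ω : TopologicalSpace.Opens E3) (A : E3 → V →L[ℝ] V) : Prop :=
  (∀ᵐ x ∂(vol Ω), ∀ s t : V, ⟪A x s, t⟫_ℝ = ⟪s, A x t⟫_ℝ) ∧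
  ∃ c₀ : ℝ, 0 < c₀ ∧ ∀ᵐ x ∂(vol Ω), ∀ s : V, c₀ * ‖s‖ ^ 2 ≤ ⟪A x s, s⟫_ℝ

end Piezo

end

/-! Substituting `E = -∇φ` and adding the two weak equations gives one variational problem on
`W^{1,2}_0 × W^{1,2}_0`. The piezoelectric coupling enters it as `(∇φ, e ε(v)) - (e ε(u), ∇ψ)`,
which is skew: it vanishes for `v = u`, `ψ = φ`, so no smallness of `e` is needed. What remains on
the diagonal is `(C ε(u), ε(u)) + (ϵ ∇φ, ∇φ)`, bounded below by a multiple of `‖ε(u)‖² + ‖∇φ‖²`.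

This controls the full norm of `W^{1,2}_0` by Korn's inequality (`sum_norm_sq_wderiv_le_strainCLM`)
and Poincaré's inequality (`norm_sq_le_sum_wderiv`). Both are proved for test functions by
integration by parts on the whole space and pass to the closure by `le_of_testFunction`. Lax–Milgram
then gives existence and uniqueness (`exists_unique_skewCoupled`), and testing with the solution
itself gives the estimate (`norm_le_of_skewCoupled`). -/

noncomputable section

namespace Piezo

/-! ### Integration by parts and the Poincaré inequality for smooth functions. -/

section Smooth

variable {F : Type} [NormedAddCommGroup F] [InnerProductSpace ℝ F]

/-- The classical partial derivative `∂ₖ f` of a vector-valued function. -/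
def pderiv (f : E3 → F) (k : Fin 3) (x : E3) : F :=
  fderiv ℝ f x (EuclideanSpace.single k 1)

lemma contDiff_pderiv {f : E3 → F} (hf : ContDiff ℝ ∞ f) (k : Fin 3) :
    ContDiff ℝ ∞ (pderiv f k) :=
  (hf.fderiv_right (m := ∞) (by simp)).clm_apply contDiff_const

lemma hasCompactSupport_pderiv {f : E3 → F} (hf : HasCompactSupport f) (k : Fin 3) :
    HasCompactSupport (pderiv f k) :=
  hf.fderiv_apply ℝ _

lemma pderiv_eq_zero_of_notMem {f : E3 → F} {s : Set E3} (hf : tsupport f ⊆ s) (k : Fin 3)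
    {x : E3} (hx : x ∉ s) : pderiv f k x = 0 := by
  have : fderiv ℝ f x = 0 := by
    by_contra h
    exact hx (hf (support_fderiv_subset ℝ h))
  simp [pderiv, this]

lemma pderiv_clm_comp {G : Type} [NormedAddCommGroup G] [InnerProductSpace ℝ G]
    (L : F →L[ℝ] G) {f : E3 → F} (hf : ContDiff ℝ ∞ f) (k : Fin 3) (x : E3) :
    pderiv (fun y => L (f y)) k x = L (pderiv f k x) := by
  have h := L.hasFDerivAt.comp x (hf.differentiable (by simp) x).hasFDerivAt
  change fderiv ℝ (L ∘ f) x _ = _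
  rw [h.fderiv]
  rfl

/-- Integration by parts for a continuous bilinear map. -/
lemma integral_bilin_pderiv {G W : Type} [NormedAddCommGroup G] [InnerProductSpace ℝ G]
    [NormedAddCommGroup W] [NormedSpace ℝ W] (B : F →L[ℝ] G →L[ℝ] W)
    {f : E3 → F} {g : E3 → G} (hf : ContDiff ℝ ∞ f) (hg : ContDiff ℝ ∞ g)
    (hgs : HasCompactSupport g) (k : Fin 3) :
    ∫ x, B (f x) (pderiv g k x) = - ∫ x, B (pderiv f k x) (g x) := by
  have hf' := (contDiff_pderiv hf k).continuous
  have hg' := (contDiff_pderiv hg k).continuous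
  have hgs' := hasCompactSupport_pderiv hgs k
  have key : ∀ {a : E3 → F} {b : E3 → G}, Continuous a → Continuous b → HasCompactSupport b →
      Integrable (fun x => B (a x) (b x)) := fun ha hb hbs =>
    ((B.continuous.comp ha).clm_apply hb).integrable_of_hasCompactSupport
      (hbs.mono (by intro x hx; contrapose! hx; simp_all))
  exact integral_bilinear_fderiv_right_eq_neg_left_of_integrable (B := B)
    (key hf' hg.continuous hgs) (key hf.continuous hg' hgs') (key hf.continuous hg.continuous hgs)
    (fun x _ => hf.differentiable (by simp) x) (fun x _ => hg.differentiable (by simp) x)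

lemma pderiv_comm {f : E3 → F} (hf : ContDiff ℝ ∞ f) (i j : Fin 3) (x : E3) :
    pderiv (pderiv f i) j x = pderiv (pderiv f j) i x := by
  have hs : IsSymmSndFDerivAt ℝ f x :=
    hf.contDiffAt.isSymmSndFDerivAt (by simpa using ENat.LEInfty.out)
  have hd : DifferentiableAt ℝ (fderiv ℝ f) x :=
    (hf.fderiv_right (m := ∞) (by simp)).differentiable (by simp) x
  have key : ∀ v w : E3, fderiv ℝ (fun y => fderiv ℝ f y v) x w = fderiv ℝ (fderiv ℝ f) x w v := by
    intro v w
    rw [fderiv_clm_apply hd (differentiableAt_const v)]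
    simp
  change fderiv ℝ (fun y => fderiv ℝ f y _) x _ = fderiv ℝ (fun y => fderiv ℝ f y _) x _
  rw [key, key]
  exact hs _ _

/-- Both sides equal `-∫ (∂ᵢ∂ⱼ a) b` after one integration by parts, since second derivatives
commute. -/
lemma integral_pderiv_mul_pderiv_comm {a b : E3 → ℝ} (ha : ContDiff ℝ ∞ a) (hb : ContDiff ℝ ∞ b)
    (hbs : HasCompactSupport b) (i j : Fin 3) :
    ∫ x, pderiv a j x * pderiv b i x = ∫ x, pderiv a i x * pderiv b j x := by
  have h1 := integral_bilin_pderiv (ContinuousLinearMap.mul ℝ ℝ) (contDiff_pderiv ha j) hb hbs i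
  have h2 := integral_bilin_pderiv (ContinuousLinearMap.mul ℝ ℝ) (contDiff_pderiv ha i) hb hbs j
  simp only [ContinuousLinearMap.mul_apply'] at h1 h2
  rw [h1, h2]
  simp_rw [pderiv_comm ha i j]

/-- The Poincaré inequality for smooth functions supported in a ball of radius `R`. -/
lemma integral_norm_sq_le_pderiv {f : E3 → F} (hf : ContDiff ℝ ∞ f) (hs : HasCompactSupport f)
    {R : ℝ} (hR : ∀ x, f x ≠ 0 → ‖x‖ ≤ R) :
    ∫ x, ‖f x‖ ^ 2 ≤ 4 * R ^ 2 * ∫ x, ‖pderiv f 0 x‖ ^ 2 := by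
  have hx0 : ContDiff ℝ ∞ (fun x : E3 => x 0) := contDiff_piLp_apply (p := 2)
  -- The multiplier is the coordinate `x 0`, whose derivative in direction `0` is `1`. Integrating
  -- `⟪f, ∂₀(x₀ f)⟫` by parts yields `∫ ‖f‖² = -2 ∫ x₀ ⟪f, ∂₀ f⟫`.
  have hg : ContDiff ℝ ∞ (fun x : E3 => x 0 • f x) := hx0.smul hf
  have hp := (contDiff_pderiv hf 0).continuous
  have hps := hasCompactSupport_pderiv hs 0
  have hgd : ∀ x, pderiv (fun x : E3 => x 0 • f x) 0 x = f x + x 0 • pderiv f 0 x := by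
    intro x
    have h1 : HasFDerivAt (fun x : E3 => x 0) (EuclideanSpace.proj (𝕜 := ℝ) (0 : Fin 3)) x :=
      (EuclideanSpace.proj (𝕜 := ℝ) (0 : Fin 3)).hasFDerivAt
    have h2 := h1.smul (hf.differentiable (by simp) x).hasFDerivAt
    unfold pderiv
    erw [h2.fderiv]
    simp [add_comm]
  have ibp := integral_bilin_pderiv (innerSL ℝ) hf hg hs.smul_left 0
  simp only [hgd] at ibp
  change ∫ x, ⟪f x, f x + x 0 • pderiv f 0 x⟫_ℝ = - ∫ x, ⟪pderiv f 0 x, x 0 • f x⟫_ℝ at ibp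
  have i1 : Integrable (fun x => ‖f x‖ ^ 2) :=
    (hf.continuous.norm.pow 2).integrable_of_hasCompactSupport
      (hs.mono (by intro x hx; contrapose! hx; simp_all))
  have i2 : Integrable (fun x => ‖pderiv f 0 x‖ ^ 2) :=
    (hp.norm.pow 2).integrable_of_hasCompactSupport
      (hps.mono (by intro x hx; contrapose! hx; simp_all))
  have i3 : Integrable (fun x => x 0 * ⟪f x, pderiv f 0 x⟫_ℝ) :=
    (hx0.continuous.mul (hf.continuous.inner hp)).integrable_of_hasCompactSupport
      (hs.mono (by intro x hx; contrapose! hx; simp_all))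
  have e1 : ∫ x, ‖f x‖ ^ 2 = -2 * ∫ x, x 0 * ⟪f x, pderiv f 0 x⟫_ℝ := by
    have l : ∫ x, ⟪f x, f x + x 0 • pderiv f 0 x⟫_ℝ
        = (∫ x, ‖f x‖ ^ 2) + ∫ x, x 0 * ⟪f x, pderiv f 0 x⟫_ℝ := by
      rw [← integral_add i1 i3]
      congr with x
      rw [inner_add_right, real_inner_self_eq_norm_sq, real_inner_smul_right]
    have r : ∫ x, ⟪pderiv f 0 x, x 0 • f x⟫_ℝ = ∫ x, x 0 * ⟪f x, pderiv f 0 x⟫_ℝ := by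
      congr with x
      rw [real_inner_smul_right, real_inner_comm]
    rw [l, r] at ibp
    linarith
  -- Young's inequality with weight `1/2`, so that half of `∫ ‖f‖²` is absorbed on the left;
  -- doubling `2 R²` gives the constant `4 R²`. The bound `|x 0| ≤ R` is needed only where `f x ≠
  -- 0`.
  have e2 : ∫ x, -2 * (x 0 * ⟪f x, pderiv f 0 x⟫_ℝ)
      ≤ ∫ x, ((1 / 2) * ‖f x‖ ^ 2 + 2 * R ^ 2 * ‖pderiv f 0 x‖ ^ 2) := by
    refine integral_mono (i3.const_mul _) ((i1.const_mul _).add (i2.const_mul _)) fun x => ?_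
    by_cases hx : f x = 0
    · simp only [hx, inner_zero_left, mul_zero, norm_zero]
      positivity
    · have h0 : |x 0| ≤ R := (PiLp.norm_apply_le x 0).trans (hR x hx)
      have h1 := abs_real_inner_le_norm (f x) (pderiv f 0 x)
      have h2 : |x 0 * ⟪f x, pderiv f 0 x⟫_ℝ| ≤ R * (‖f x‖ * ‖pderiv f 0 x‖) := by
        rw [abs_mul]
        exact mul_le_mul h0 h1 (abs_nonneg _) ((abs_nonneg _).trans h0)
      have h3 := neg_abs_le (x 0 * ⟪f x, pderiv f 0 x⟫_ℝ)
      simp only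
      nlinarith [sq_nonneg (‖f x‖ - 2 * R * ‖pderiv f 0 x‖)]
  rw [integral_const_mul, ← e1, integral_add (i1.const_mul _) (i2.const_mul _),
    integral_const_mul, integral_const_mul] at e2
  linarith

end Smooth

/-! ### Completeness of the Sobolev spaces, density arguments and the Poincaré inequality. -/

section Sobolev

variable {Ω : TopologicalSpace.Opens E3} {F : Type} [NormedAddCommGroup F]
  [InnerProductSpace ℝ F]

lemma memLp_testFunction (f : 𝓓(Ω, F)) : MemLp f 2 (vol Ω) :=
  (f.continuous.memLp_of_hasCompactSupport f.hasCompactSupport (μ := volume)).restrict _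

lemma memLp_pderiv (f : 𝓓(Ω, F)) (k : Fin 3) : MemLp (pderiv f k) 2 (vol Ω) :=
  ((contDiff_pderiv f.contDiff k).continuous.memLp_of_hasCompactSupport
    (hasCompactSupport_pderiv f.hasCompactSupport k) (μ := volume)).restrict _

lemma memLp_partialDeriv (η : 𝓓(Ω, ℝ)) (k : Fin 3) : MemLp (partialDeriv η k) 2 (vol Ω) :=
  memLp_pderiv η k

lemma testFunction_eq_zero_of_notMem (f : 𝓓(Ω, F)) {x : E3} (hx : x ∉ (Ω : Set E3)) : f x = 0 :=
  image_eq_zero_of_notMem_tsupport fun h => hx (f.tsupport_subset h)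

/-- Extension by zero turns the norm on `Ω` into an integral over all of `ℝ³`, where integration by
parts has no boundary terms. -/
lemma norm_sq_eq_integral {V : Type} [NormedAddCommGroup V] [InnerProductSpace ℝ V]
    {u : L2 Ω V} {f : E3 → V} (hu : u =ᵐ[vol Ω] f) (hf : ∀ x ∉ (Ω : Set E3), f x = 0) :
    ‖u‖ ^ 2 = ∫ x, ‖f x‖ ^ 2 := by
  rw [← real_inner_self_eq_norm_sq, L2.inner_def,
    ← setIntegral_eq_integral_of_forall_compl_eq_zero (s := (Ω : Set E3))
      (f := fun x => ‖f x‖ ^ 2) (fun x hx => by simp [hf x hx])]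
  refine integral_congr_ae ?_
  filter_upwards [hu] with x hx
  rw [hx, real_inner_self_eq_norm_sq]

/-- An inequality between continuous functions which holds for test functions holds on
`W^{1,2}_0`. -/
lemma le_of_testFunction {p q : W12 Ω F → ℝ} (hp : Continuous p) (hq : Continuous q)
    (h : ∀ (U : W12 Ω F) (f : 𝓓(Ω, F)), U.1.fst =ᵐ[vol Ω] f → p U ≤ q U) (u : W012 Ω F) :
    p u.1 ≤ q u.1 := by
  have hcl : IsClosed {U : W12 Ω F | p U ≤ q U} := isClosed_le hp hq
  have hsub : (testSubspace Ω F : Set (W12 Ω F)) ⊆ {U : W12 Ω F | p U ≤ q U} := by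
    rintro U ⟨f, hf⟩
    exact h U f hf
  exact closure_minimal hsub hcl u.2

variable [CompleteSpace F]

lemma continuous_integral_smul {a : E3 → ℝ} (ha : MemLp a 2 (vol Ω)) :
    Continuous fun u : L2 Ω F => ∫ x in (Ω : Set E3), a x • u x := by
  have h := ((ContinuousLinearMap.lsmul ℝ ℝ : ℝ →L[ℝ] F →L[ℝ] F).lpPairing (vol Ω) 2 2
    ha.toLp).continuous
  convert h using 2 with u
  rw [ContinuousLinearMap.lpPairing_eq_integral]
  refine integral_congr_ae ?_
  filter_upwards [ha.coeFn_toLp] with x hx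
  simp [hx]

/-- Each weak-derivative identity equates two continuous functions of the jet, because a test
function and its derivatives lie in `L²`. The resulting completeness is what Lax–Milgram requires.
-/
lemma isClosed_W12 : IsClosed (W12 Ω F : Set (Jet Ω F)) := by
  have : (W12 Ω F : Set (Jet Ω F)) = ⋂ (k : Fin 3) (η : 𝓓(Ω, ℝ)),
      {U : Jet Ω F | ∫ x in (Ω : Set E3), partialDeriv η k x • U.fst x =
        - ∫ x in (Ω : Set E3), η x • U.snd k x} := by
    ext U
    simp [W12, IsWeakPartialDeriv]
  rw [this]
  refine isClosed_iInter fun k => isClosed_iInter fun η => isClosed_eq ?_ ?_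
  · exact (continuous_integral_smul (memLp_partialDeriv η k)).comp
      (WithLp.fstL 2 ℝ _ _).continuous
  · exact ((continuous_integral_smul (memLp_testFunction η)).comp
      ((PiLp.proj 2 (𝕜 := ℝ) (fun _ : Fin 3 => L2 Ω F) k).continuous.comp
      (WithLp.sndL 2 ℝ _ _).continuous)).neg

instance instCompleteSpaceW12 : CompleteSpace (W12 Ω F) :=
  isClosed_W12.completeSpace_coe

instance instCompleteSpaceW012 : CompleteSpace (W012 Ω F) :=
  (testSubspace Ω F).isClosed_topologicalClosure.completeSpace_coe

/-- The weak partial derivatives of a test function are the classical ones. -/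
lemma snd_ae_eq_pderiv {U : W12 Ω F} {f : 𝓓(Ω, F)} (hf : U.1.fst =ᵐ[vol Ω] f) (k : Fin 3) :
    U.1.snd k =ᵐ[vol Ω] pderiv f k := by
  have hloc : LocallyIntegrableOn (fun x => U.1.snd k x - pderiv f k x) Ω := by
    exact locallyIntegrableOn_of_locallyIntegrable_restrict
      (((Lp.memLp (U.1.snd k)).sub (memLp_pderiv f k)).locallyIntegrable (by simp))
  -- Fundamental lemma of the calculus of variations: it remains to see that the difference of the
  -- weak and the classical derivative integrates to zero against every test function `g`.
  -- Integrating the classical one by parts gives the same value as the definition of the weak one.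
  have := Ω.isOpen.ae_eq_zero_of_integral_contDiff_smul_eq_zero hloc ?_
  · filter_upwards [(ae_restrict_iff' Ω.isOpen.measurableSet).2 this] with x hx
    exact sub_eq_zero.1 hx
  · intro g hg hgs hgΩ
    let η : 𝓓(Ω, ℝ) := ⟨g, hg, hgs, hgΩ⟩
    have hU := U.2 k η
    have i1 := integrable_testFunction_smul η (U.1.snd k)
    have i2 : Integrable (fun x => η x • pderiv f k x) (vol Ω) :=
      memLp_one_iff_integrable.1 ((memLp_pderiv f k).smul (memLp_testFunction η))
    have e1 : ∫ x, g x • (U.1.snd k x - pderiv f k x)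
        = ∫ x in (Ω : Set E3), (η x • U.1.snd k x - η x • pderiv f k x) := by
      rw [← setIntegral_eq_integral_of_forall_compl_eq_zero (s := (Ω : Set E3))]
      · simp only [smul_sub]; rfl
      · intro x hx
        rw [image_eq_zero_of_notMem_tsupport fun h => hx (hgΩ h), zero_smul]
    have e2 : ∫ x in (Ω : Set E3), partialDeriv η k x • U.1.fst x
        = ∫ x, pderiv g k x • f x := by
      rw [← setIntegral_eq_integral_of_forall_compl_eq_zero (s := (Ω : Set E3))
        (f := fun x => pderiv g k x • f x)
        fun x hx => by rw [pderiv_eq_zero_of_notMem hgΩ k hx, zero_smul]]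
      refine integral_congr_ae ?_
      filter_upwards [hf] with x hx
      rw [hx]; rfl
    have e3 : ∫ x in (Ω : Set E3), η x • pderiv f k x = ∫ x, g x • pderiv f k x := by
      refine setIntegral_eq_integral_of_forall_compl_eq_zero fun x hx => ?_
      change g x • _ = _
      rw [image_eq_zero_of_notMem_tsupport fun h => hx (hgΩ h), zero_smul]
    have ibp := integral_bilin_pderiv (ContinuousLinearMap.lsmul ℝ ℝ : ℝ →L[ℝ] F →L[ℝ] F)
      hg f.contDiff f.hasCompactSupport k
    simp only [ContinuousLinearMap.lsmul_apply] at ibp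
    rw [e1, integral_sub i1 i2, e3, ibp, ← e2, hU]
    simp

lemma norm_fst_sq_le (u : W012 Ω F) {R : ℝ} (hR : ∀ x ∈ Ω, ‖x‖ ≤ R) :
    ‖u.1.1.fst‖ ^ 2 ≤ 4 * R ^ 2 * ‖wderiv u 0‖ ^ 2 := by
  refine le_of_testFunction (p := fun U => ‖U.1.fst‖ ^ 2)
    (q := fun U => 4 * R ^ 2 * ‖U.1.snd 0‖ ^ 2) ?_ ?_ ?_ u
  · exact (((WithLp.fstL 2 ℝ _ _).continuous.comp continuous_subtype_val).norm).pow 2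
  · exact continuous_const.mul ((((PiLp.proj 2 (𝕜 := ℝ) (fun _ : Fin 3 => L2 Ω F) 0).continuous.comp
      (WithLp.sndL 2 ℝ _ _).continuous).comp continuous_subtype_val).norm.pow 2)
  · intro U f hf
    have h1 := norm_sq_eq_integral hf fun x hx => testFunction_eq_zero_of_notMem f hx
    have h2 := norm_sq_eq_integral (snd_ae_eq_pderiv hf 0)
      fun x hx => pderiv_eq_zero_of_notMem f.tsupport_subset 0 hx
    simp only [h1, h2]
    refine integral_norm_sq_le_pderiv f.contDiff f.hasCompactSupport fun x hx => hR x ?_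
    by_contra h
    exact hx (testFunction_eq_zero_of_notMem f h)

/-- The Poincaré inequality. -/
lemma norm_sq_le_sum_wderiv (u : W012 Ω F) {R : ℝ} (hR : ∀ x ∈ Ω, ‖x‖ ≤ R) :
    ‖u‖ ^ 2 ≤ (4 * R ^ 2 + 1) * ∑ k, ‖wderiv u k‖ ^ 2 := by
  -- The Sobolev norm is the norm of the jet, so the derivatives themselves contribute the `1` in `4
  -- R² + 1`.
  have h1 : ‖u‖ ^ 2 = ‖u.1.1.fst‖ ^ 2 + ∑ k, ‖wderiv u k‖ ^ 2 := by
    change ‖u.1.1‖ ^ 2 = _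
    rw [WithLp.prod_norm_sq_eq_of_L2, PiLp.norm_sq_eq_of_L2]
    rfl
  have h2 := norm_fst_sq_le u hR
  have h3 : ‖wderiv u 0‖ ^ 2 ≤ ∑ k, ‖wderiv u k‖ ^ 2 :=
    Finset.single_le_sum (f := fun k => ‖wderiv u k‖ ^ 2) (fun _ _ => sq_nonneg _)
      (Finset.mem_univ 0)
  nlinarith [mul_le_mul_of_nonneg_left h3 (by positivity : 0 ≤ 4 * R ^ 2)]

end Sobolev

end Piezo

end

/-! ### Strain and gradient as bounded operators; Korn's inequality. -/

noncomputable section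

namespace Piezo

variable {Ω : TopologicalSpace.Opens E3}

/-- The symmetric part of the matrix `w ⊗ e_k`, whose `k`-th column is `w`. -/
def symColumn (k : Fin 3) : E3 →L[ℝ] S3 :=
  LinearMap.toContinuousLinearMap
    { toFun := fun w => ⟨WithLp.toLp 2 fun p =>
        ((if p.2 = k then w p.1 else 0) + (if p.1 = k then w p.2 else 0)) / 2, by
          intro i j
          change (_ + _) / 2 = (_ + _) / 2
          rw [add_comm]⟩
      map_add' := by
        intro v w
        ext p
        simp only [PiLp.add_apply, Submodule.coe_add]
        split_ifs <;> ring
      map_smul' := by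
        intro a w
        ext p
        simp only [PiLp.smul_apply, Submodule.coe_smul, RingHom.id_apply, smul_eq_mul]
        split_ifs <;> ring }

lemma sum_symColumn_apply (D : Fin 3 → E3) (p : Fin 3 × Fin 3) :
    (∑ k, symColumn k (D k) : S3).1 p = (D p.2 p.1 + D p.1 p.2) / 2 := by
  have h : ∀ k, (symColumn k (D k)).1 p =
      ((if p.2 = k then D k p.1 else 0) + (if p.1 = k then D k p.2 else 0)) / 2 := fun _ => rfl
  rw [AddSubmonoidClass.coe_finsetSum, WithLp.ofLp_sum, Finset.sum_apply]
  simp only [h]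
  rw [← Finset.sum_div, Finset.sum_add_distrib]
  simp

/-- The pointwise identity behind Korn's inequality: `2 |sym D|² = |D|² + tr(D²)`. The trace term
has no pointwise sign; only its integral does. -/
lemma two_mul_norm_sq_sum_symColumn (D : Fin 3 → E3) :
    2 * ‖∑ k, symColumn k (D k)‖ ^ 2 = ∑ k, ‖D k‖ ^ 2 + ∑ i, ∑ j, D j i * D i j := by
  have h : ‖∑ k, symColumn k (D k)‖ ^ 2
      = ∑ p : Fin 3 × Fin 3, ((D p.2 p.1 + D p.1 p.2) / 2) ^ 2 := by
    rw [← Submodule.norm_coe, EuclideanSpace.norm_sq_eq]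
    refine Finset.sum_congr rfl fun p _ => ?_
    rw [← sum_symColumn_apply D p, Real.norm_eq_abs, sq_abs]
  rw [h]
  simp only [EuclideanSpace.norm_sq_eq, Real.norm_eq_abs, sq_abs, Fintype.sum_prod_type,
    Fin.sum_univ_three]
  ring

/-- The weak partial derivative `∂ₖ` as a continuous linear map. -/
def wderivCLM (F : Type) [NormedAddCommGroup F] [InnerProductSpace ℝ F] (k : Fin 3) :
    W12 Ω F →L[ℝ] L2 Ω F :=
  (PiLp.proj 2 (𝕜 := ℝ) (fun _ : Fin 3 => L2 Ω F) k) ∘L (WithLp.sndL 2 ℝ _ _) ∘L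
    (W12 Ω F).subtypeL

/-- The bounded operators `W^{1,2}(Ω, F) → L²(Ω, V)`. -/
abbrev SobolevOp (Ω : TopologicalSpace.Opens E3) (F V : Type) [NormedAddCommGroup F]
    [InnerProductSpace ℝ F] [NormedAddCommGroup V] [InnerProductSpace ℝ V] : Type :=
  W12 Ω F →L[ℝ] L2 Ω V

/-- The bounded operators `L²(Ω, V) → L²(Ω, W)`. -/
abbrev L2Op (Ω : TopologicalSpace.Opens E3) (V W : Type) [NormedAddCommGroup V]
    [InnerProductSpace ℝ V] [NormedAddCommGroup W] [InnerProductSpace ℝ W] : Type :=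
  L2 Ω V →L[ℝ] L2 Ω W

/-- The first-order differential operator `U ↦ ∑ k, L k (∂ₖ U)` with constant coefficients. -/
def diffOp {F V : Type} [NormedAddCommGroup F] [InnerProductSpace ℝ F]
    [NormedAddCommGroup V] [InnerProductSpace ℝ V] (L : Fin 3 → F →L[ℝ] V) : SobolevOp Ω F V :=
  ∑ k, (L k).compLpL 2 (vol Ω) ∘L wderivCLM F k

/-- The linearized strain as a continuous linear map `W^{1,2} → L²`. -/
def strainCLM : SobolevOp Ω E3 S3 :=
  diffOp symColumn

/-- The gradient as a continuous linear map `W^{1,2} → L²`. -/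
def gradCLM : SobolevOp Ω ℝ E3 :=
  diffOp fun k => ContinuousLinearMap.toSpanSingleton ℝ (EuclideanSpace.single k (1 : ℝ))

lemma diffOp_ae_eq {F V : Type} [NormedAddCommGroup F] [InnerProductSpace ℝ F]
    [NormedAddCommGroup V] [InnerProductSpace ℝ V] (L : Fin 3 → F →L[ℝ] V) (U : W12 Ω F) :
    diffOp L U =ᵐ[vol Ω]
      fun x => ∑ k, L k (U.1.snd k x) := by
  have h : diffOp L U = ∑ k, (L k).compLpL 2 (vol Ω) (U.1.snd k) := by
    rw [diffOp, sum_apply]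
    rfl
  rw [h]
  refine (Lp.coeFn_finsetSum _ _).trans ?_
  have hk : ∀ k, (L k).compLpL 2 (vol Ω) (U.1.snd k) =ᵐ[vol Ω] fun x => L k (U.1.snd k x) :=
    fun k => ContinuousLinearMap.coeFn_compLpL _ _
  filter_upwards [Filter.eventually_all.2 hk] with x hx
  rw [Finset.sum_apply]
  exact Finset.sum_congr rfl fun k _ => hx k

lemma strainCLM_ae_eq (u : W012 Ω E3) : strainCLM u.1 =ᵐ[vol Ω] strain u := by
  filter_upwards [diffOp_ae_eq symColumn u.1] with x hx
  refine hx.trans ?_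
  ext p
  exact sum_symColumn_apply _ p

lemma gradCLM_ae_eq (φ : W012 Ω ℝ) : gradCLM φ.1 =ᵐ[vol Ω] grad φ := by
  filter_upwards [diffOp_ae_eq (fun k => ContinuousLinearMap.toSpanSingleton ℝ
    (EuclideanSpace.single k (1 : ℝ))) φ.1] with x hx
  refine hx.trans ?_
  ext i
  simp [grad, wderiv, Finset.sum_apply, Pi.single_apply]

lemma norm_sq_gradCLM (φ : W12 Ω ℝ) : ‖gradCLM φ‖ ^ 2 = ∑ k, ‖φ.1.snd k‖ ^ 2 := by
  have h := diffOp_ae_eq (fun k => ContinuousLinearMap.toSpanSingleton ℝ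
    (EuclideanSpace.single k (1 : ℝ))) φ
  rw [← real_inner_self_eq_norm_sq, L2.inner_def]
  have hk : ∀ k, ‖φ.1.snd k‖ ^ 2 = ∫ x in (Ω : Set E3), φ.1.snd k x * φ.1.snd k x := by
    intro k
    rw [← real_inner_self_eq_norm_sq, L2.inner_def]
    rfl
  simp only [hk]
  rw [← integral_finsetSum]
  · refine integral_congr_ae ?_
    filter_upwards [h] with x hx
    change ⟪((gradCLM φ : L2 Ω E3) : E3 → E3) x, ((gradCLM φ : L2 Ω E3) : E3 → E3) x⟫_ℝ = _
    rw [show ((gradCLM φ : L2 Ω E3) : E3 → E3) x = _ from hx]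
    rw [PiLp.inner_apply]
    refine Finset.sum_congr rfl fun i _ => ?_
    simp [Finset.sum_apply, Pi.single_apply, sq]
  · intro k _
    exact L2.integrable_inner (φ.1.snd k) (φ.1.snd k)

lemma pderiv_apply {f : E3 → E3} (hf : ContDiff ℝ ∞ f) (k i : Fin 3) (x : E3) :
    pderiv (fun y => f y i) k x = pderiv f k x i :=
  pderiv_clm_comp (EuclideanSpace.proj (𝕜 := ℝ) i) hf k x

/-- Integrating by parts twice exchanges the derivatives in `∂ⱼfᵢ ∂ᵢfⱼ`, so the integral of the
trace term equals `∫ (div f)² ≥ 0` and may be dropped. -/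
lemma korn_smooth {f : E3 → E3} (hf : ContDiff ℝ ∞ f) (hs : HasCompactSupport f) :
    ∑ k, ∫ x, ‖pderiv f k x‖ ^ 2 ≤ 2 * ∫ x, ‖∑ k, symColumn k (pderiv f k x)‖ ^ 2 := by
  have hc : ∀ k, Continuous (pderiv f k) := fun k => (contDiff_pderiv hf k).continuous
  have hcs : ∀ k, HasCompactSupport (pderiv f k) := fun k => hasCompactSupport_pderiv hs k
  have hci : ∀ k i, Continuous fun x => pderiv f k x i := fun k i =>
    (EuclideanSpace.proj (𝕜 := ℝ) i).continuous.comp (hc k)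
  have hint : ∀ i j k l, Integrable fun x => pderiv f i x j * pderiv f k x l := fun i j k l =>
    ((hci i j).mul (hci k l)).integrable_of_hasCompactSupport
      ((hcs i).mono (by intro x hx; contrapose! hx; simp_all))
  have hn : ∀ k, Integrable fun x => ‖pderiv f k x‖ ^ 2 := fun k =>
    ((hc k).norm.pow 2).integrable_of_hasCompactSupport
      ((hcs k).mono (by intro x hx; contrapose! hx; simp_all))
  have hcomp : ∀ i, ContDiff ℝ ∞ fun x => f x i := fun i =>
    (EuclideanSpace.proj (𝕜 := ℝ) i).contDiff.comp hf
  have hcomps : ∀ i, HasCompactSupport fun x => f x i := fun i =>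
    hs.mono (by intro x hx; contrapose! hx; simp_all)
  have hswap : ∀ i j, ∫ x, pderiv f j x i * pderiv f i x j
      = ∫ x, pderiv f i x i * pderiv f j x j := by
    intro i j
    have := integral_pderiv_mul_pderiv_comm (hcomp i) (hcomp j) (hcomps j) i j
    simpa only [pderiv_apply hf] using this
  have hsum : ∀ A : Fin 3 → Fin 3 → E3 → ℝ, (∀ i j, Integrable (A i j)) →
      ∫ x, ∑ i, ∑ j, A i j x = ∑ i, ∑ j, ∫ x, A i j x := by
    intro A hA
    rw [integral_finsetSum _ fun i _ => integrable_finsetSum _ fun j _ => hA i j]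
    exact Finset.sum_congr rfl fun i _ => integral_finsetSum _ fun j _ => hA i j
  have hdiv : 0 ≤ ∫ x, ∑ i, ∑ j, pderiv f j x i * pderiv f i x j := by
    have : ∫ x, ∑ i, ∑ j, pderiv f j x i * pderiv f i x j
        = ∫ x, (∑ i, pderiv f i x i) ^ 2 := by
      simp only [sq, Finset.sum_mul_sum]
      rw [hsum _ fun i j => hint j i i j, hsum _ fun i j => hint i i j j]
      exact Finset.sum_congr rfl fun i _ => Finset.sum_congr rfl fun j _ => hswap i j
    rw [this]
    exact integral_nonneg fun x => sq_nonneg _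
  rw [← integral_const_mul]
  simp only [two_mul_norm_sq_sum_symColumn]
  rw [integral_add (integrable_finsetSum _ fun k _ => hn k)
    (integrable_finsetSum _ fun i _ => integrable_finsetSum _ fun j _ => hint _ _ _ _),
    integral_finsetSum _ fun k _ => hn k]
  linarith

lemma continuous_norm_comp {X V : Type} [NormedAddCommGroup X] [NormedSpace ℝ X]
    [NormedAddCommGroup V] [InnerProductSpace ℝ V] (L : X →L[ℝ] L2 Ω V) :
    Continuous fun x => ‖L x‖ :=
  L.continuous.norm

/-- Korn's inequality on `W^{1,2}_0`. -/
lemma sum_norm_sq_wderiv_le_strainCLM (u : W012 Ω E3) :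
    ∑ k, ‖wderiv u k‖ ^ 2 ≤ 2 * ‖strainCLM u.1‖ ^ 2 := by
  refine le_of_testFunction (p := fun U => ∑ k, ‖U.1.snd k‖ ^ 2)
    (q := fun U => 2 * ‖strainCLM U‖ ^ 2) ?_ ?_ ?_ u
  · exact continuous_finsetSum _ fun k _ => (wderivCLM E3 k).continuous.norm.pow 2
  · exact continuous_const.mul ((continuous_norm_comp strainCLM).pow 2)
  · intro U f hf
    have hk := fun k => snd_ae_eq_pderiv hf k
    have hz : ∀ k, ∀ x ∉ (Ω : Set E3), pderiv f k x = 0 := fun k x hx =>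
      pderiv_eq_zero_of_notMem f.tsupport_subset k hx
    have h1 := fun k => norm_sq_eq_integral (hk k) (hz k)
    have h2 : strainCLM U =ᵐ[vol Ω] fun x => ∑ k, symColumn k (pderiv f k x) := by
      filter_upwards [diffOp_ae_eq symColumn U, Filter.eventually_all.2 hk] with x hx hkx
      refine hx.trans (Finset.sum_congr rfl fun k _ => ?_)
      rw [hkx k]
    have h3 := norm_sq_eq_integral h2 fun x hx => by simp [hz _ x hx]
    simp only [h1, h3]
    exact korn_smooth f.contDiff f.hasCompactSupport

/-! ### Bounded coefficient fields as operators on `L²`. -/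

section Multiplication

variable {V W : Type} [NormedAddCommGroup V] [InnerProductSpace ℝ V]
  [NormedAddCommGroup W] [InnerProductSpace ℝ W] {A : E3 → V →L[ℝ] W}

/-- The operator `L² → L²` of pointwise application of a bounded measurable field of
linear maps. -/
def applyCLM (hA : MemLp A ∞ (vol Ω)) : L2Op Ω V W :=
  (ContinuousLinearMap.id ℝ (V →L[ℝ] W)).holderL (vol Ω) ∞ 2 2 hA.toLp

lemma applyCLM_ae_eq (hA : MemLp A ∞ (vol Ω)) (u : L2 Ω V) :
    applyCLM hA u =ᵐ[vol Ω] fun x => A x (u x) := by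
  filter_upwards [(ContinuousLinearMap.id ℝ (V →L[ℝ] W)).coeFn_holder (r := 2) hA.toLp u,
    hA.coeFn_toLp] with x hx hA'
  refine hx.trans ?_
  rw [hA']
  rfl

lemma le_inner_applyCLM {A : E3 → V →L[ℝ] V} (hA : MemLp A ∞ (vol Ω)) {c : ℝ}
    (hc : ∀ᵐ x ∂(vol Ω), ∀ s : V, c * ‖s‖ ^ 2 ≤ ⟪A x s, s⟫_ℝ) (u : L2 Ω V) :
    c * ‖u‖ ^ 2 ≤ ⟪applyCLM hA u, u⟫_ℝ := by
  rw [← real_inner_self_eq_norm_sq, L2.inner_def, L2.inner_def, ← integral_const_mul]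
  refine integral_mono_ae ((L2.integrable_inner u u).const_mul c) (L2.integrable_inner _ _) ?_
  filter_upwards [applyCLM_ae_eq hA u, hc] with x hx hcx
  rw [hx, real_inner_self_eq_norm_sq]
  exact hcx (u x)

end Multiplication

end Piezo

end

/-! ### Abstract skew-coupled systems: Lax–Milgram and the energy estimate. -/

noncomputable section

section SkewCoupled

variable {X Y S E : Type*} [NormedAddCommGroup X] [InnerProductSpace ℝ X]
  [NormedAddCommGroup Y] [InnerProductSpace ℝ Y]
  [NormedAddCommGroup S] [InnerProductSpace ℝ S] [NormedAddCommGroup E] [InnerProductSpace ℝ E]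

/-- The energy estimate for a system of two coercive variational equations with a skew
coupling. -/
theorem norm_le_of_skewCoupled (T : X →L[ℝ] S) (G : Y →L[ℝ] E) (C : S →L[ℝ] S) (M : E →L[ℝ] E)
    (e : S →L[ℝ] E) {c : ℝ} (hc : 0 < c) (hC : ∀ u, c * ‖u‖ ^ 2 ≤ ⟪C (T u), T u⟫_ℝ)
    (hM : ∀ φ, c * ‖φ‖ ^ 2 ≤ ⟪M (G φ), G φ⟫_ℝ) (l : StrongDual ℝ X) (m : StrongDual ℝ Y)
    {u : X} {φ : Y} (h1 : ⟪C (T u), T u⟫_ℝ + ⟪G φ, e (T u)⟫_ℝ = l u)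
    (h2 : ⟪M (G φ), G φ⟫_ℝ - ⟪e (T u), G φ⟫_ℝ = m φ) :
    ‖u‖ + ‖φ‖ ≤ 2 / c * (‖l‖ + ‖m‖) := by
  have hu := hC u
  have hφ := hM φ
  have hl := (le_abs_self _).trans (l.le_opNorm u)
  have hm := (le_abs_self _).trans (m.le_opNorm φ)
  rw [real_inner_comm (G φ) (e (T u))] at h2
  -- Adding `h1` and `h2` cancels the coupling. The factor `2` comes from `(a + b)² ≤ 2 (a² + b²)`;
  -- the cross terms `‖l‖ ‖φ‖` and `‖m‖ ‖u‖` are added to complete the product.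
  have key : c * (‖u‖ + ‖φ‖) ^ 2 ≤ 2 * (‖l‖ + ‖m‖) * (‖u‖ + ‖φ‖) := by
    nlinarith [mul_nonneg hc.le (sq_nonneg (‖u‖ - ‖φ‖)), mul_nonneg (norm_nonneg l) (norm_nonneg φ),
      mul_nonneg (norm_nonneg m) (norm_nonneg u)]
  rcases (add_nonneg (norm_nonneg u) (norm_nonneg φ)).eq_or_lt with h0 | h0
  · rw [← h0]
    positivity
  · rw [div_mul_eq_mul_div, le_div_iff₀ hc]
    nlinarith

variable [CompleteSpace X] [CompleteSpace Y]

/-- Well-posedness of a system of two coercive variational equations with a skew coupling. -/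
theorem exists_unique_skewCoupled (T : X →L[ℝ] S) (G : Y →L[ℝ] E) (C : S →L[ℝ] S) (M : E →L[ℝ] E)
    (e : S →L[ℝ] E) {c : ℝ} (hc : 0 < c) (hC : ∀ u, c * ‖u‖ ^ 2 ≤ ⟪C (T u), T u⟫_ℝ)
    (hM : ∀ φ, c * ‖φ‖ ^ 2 ≤ ⟪M (G φ), G φ⟫_ℝ) (l : StrongDual ℝ X) (m : StrongDual ℝ Y) :
    ∃! U : X × Y, (∀ v, ⟪C (T U.1), T v⟫_ℝ + ⟪G U.2, e (T v)⟫_ℝ = l v) ∧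
      ∀ ψ, ⟪M (G U.2), G ψ⟫_ℝ - ⟪e (T U.1), G ψ⟫_ℝ = m ψ := by
  -- The `L²` product norm makes `X × Y` a Hilbert space with `‖U‖² = ‖u‖² + ‖φ‖²`, so the two
  -- coercivity bounds simply add.
  let p : WithLp 2 (X × Y) →L[ℝ] X := WithLp.fstL 2 ℝ X Y
  let q : WithLp 2 (X × Y) →L[ℝ] Y := WithLp.sndL 2 ℝ X Y
  let iS : S →L[ℝ] S →L[ℝ] ℝ := innerSL ℝ
  let iE : E →L[ℝ] E →L[ℝ] ℝ := innerSL ℝ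
  let B : WithLp 2 (X × Y) →L[ℝ] WithLp 2 (X × Y) →L[ℝ] ℝ :=
    iS.bilinearComp (C ∘L T ∘L p) (T ∘L p) + iE.bilinearComp (G ∘L q) (e ∘L T ∘L p)
      + iE.bilinearComp (M ∘L G ∘L q) (G ∘L q) - iE.bilinearComp (e ∘L T ∘L p) (G ∘L q)
  have hB : ∀ U V : WithLp 2 (X × Y), B U V = ⟪C (T U.fst), T V.fst⟫_ℝ + ⟪G U.snd, e (T V.fst)⟫_ℝ
      + ⟪M (G U.snd), G V.snd⟫_ℝ - ⟪e (T U.fst), G V.snd⟫_ℝ := fun _ _ => rfl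
  have hco : IsCoercive B := by
    refine ⟨c, hc, fun U => ?_⟩
    have h1 := hC U.fst
    have h2 := hM U.snd
    rw [hB, real_inner_comm (e (T U.fst)) (G U.snd), mul_assoc, ← sq, WithLp.prod_norm_sq_eq_of_L2]
    linarith
  -- The system is one equation for the Lax–Milgram isomorphism, whose bijectivity gives both
  -- existence and uniqueness. Testing with `(v, 0)` and `(0, ψ)` recovers the separate equations.
  have hiff : ∀ U : WithLp 2 (X × Y), ((∀ v, ⟪C (T U.fst), T v⟫_ℝ + ⟪G U.snd, e (T v)⟫_ℝ = l v) ∧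
      ∀ ψ, ⟪M (G U.snd), G ψ⟫_ℝ - ⟪e (T U.fst), G ψ⟫_ℝ = m ψ) ↔
      hco.continuousLinearEquivOfBilin U
        = (InnerProductSpace.toDual ℝ _).symm (l ∘L p + m ∘L q) := by
    intro U
    constructor
    · rintro ⟨h1, h2⟩
      refine ext_inner_right ℝ fun V => ?_
      rw [hco.continuousLinearEquivOfBilin_apply, hB, InnerProductSpace.toDual_symm_apply]
      change _ = l V.fst + m V.snd
      rw [← h1, ← h2]
      ring
    · intro h
      have h' : ∀ V : WithLp 2 (X × Y), B U V = l V.fst + m V.snd := by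
        intro V
        rw [← hco.continuousLinearEquivOfBilin_apply, h, InnerProductSpace.toDual_symm_apply]
        rfl
      constructor
      · intro v
        have := h' (WithLp.toLp 2 (v, 0))
        rw [hB] at this
        simpa using this
      · intro ψ
        have := h' (WithLp.toLp 2 (0, ψ))
        rw [hB] at this
        simpa using this
  obtain ⟨U, hU⟩ := hco.continuousLinearEquivOfBilin.surjective
    ((InnerProductSpace.toDual ℝ _).symm (l ∘L p + m ∘L q))
  refine ⟨(U.fst, U.snd), (hiff U).2 hU, fun V hV => ?_⟩
  have := (hiff (WithLp.toLp 2 V)).1 hV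
  rw [← hU] at this
  rw [← hco.continuousLinearEquivOfBilin.injective this]
  rfl

/-- Well-posedness of the piezoelectric equations in abstract form: `T` is the strain, `G` the
gradient, and `C`, `M`, `e` are the elastic, dielectric and piezoelectric operators. -/
theorem skewCoupled_wellPosed (T : X →L[ℝ] S) (G : Y →L[ℝ] E) (C : S →L[ℝ] S) (M : E →L[ℝ] E)
    (e : S →L[ℝ] E) {K c₁ c₂ : ℝ} (hK : 0 < K) (hc₁ : 0 < c₁) (hc₂ : 0 < c₂)
    (hT : ∀ u, ‖u‖ ^ 2 ≤ K * ‖T u‖ ^ 2) (hG : ∀ φ, ‖φ‖ ^ 2 ≤ K * ‖G φ‖ ^ 2)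
    (hC : ∀ s, c₁ * ‖s‖ ^ 2 ≤ ⟪C s, s⟫_ℝ) (hM : ∀ s, c₂ * ‖s‖ ^ 2 ≤ ⟪M s, s⟫_ℝ) :
    ∃ c : ℝ, 0 < c ∧ ∀ (r : S) (P : E) (b : StrongDual ℝ X) (q : StrongDual ℝ Y),
      (∃! U : X × Y, (∀ v, ⟪C (T U.1 - r), T v⟫_ℝ + ⟪G U.2, e (T v)⟫_ℝ = b v) ∧
        ∀ ψ, -⟪e (T U.1 - r) - M (G U.2) + P, G ψ⟫_ℝ = q ψ) ∧
      ∀ U : X × Y, ((∀ v, ⟪C (T U.1 - r), T v⟫_ℝ + ⟪G U.2, e (T v)⟫_ℝ = b v) ∧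
        ∀ ψ, -⟪e (T U.1 - r) - M (G U.2) + P, G ψ⟫_ℝ = q ψ) →
          ‖U.1‖ + ‖U.2‖ ≤ c * (‖r‖ + ‖P‖ + ‖b‖ + ‖q‖) := by
  have hc : 0 < min c₁ c₂ / K := div_pos (lt_min hc₁ hc₂) hK
  have hCT : ∀ u, min c₁ c₂ / K * ‖u‖ ^ 2 ≤ ⟪C (T u), T u⟫_ℝ := by
    intro u
    refine le_trans ?_ (hC (T u))
    rw [div_mul_eq_mul_div, div_le_iff₀ hK]
    calc min c₁ c₂ * ‖u‖ ^ 2 ≤ c₁ * (K * ‖T u‖ ^ 2) :=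
          mul_le_mul (min_le_left _ _) (hT u) (sq_nonneg _) hc₁.le
      _ = _ := by ring
  have hMG : ∀ φ, min c₁ c₂ / K * ‖φ‖ ^ 2 ≤ ⟪M (G φ), G φ⟫_ℝ := by
    intro φ
    refine le_trans ?_ (hM (G φ))
    rw [div_mul_eq_mul_div, div_le_iff₀ hK]
    calc min c₁ c₂ * ‖φ‖ ^ 2 ≤ c₂ * (K * ‖G φ‖ ^ 2) :=
          mul_le_mul (min_le_right _ _) (hG φ) (sq_nonneg _) hc₂.le
      _ = _ := by ring
  -- `N` sums the coefficients with which `b`, `q`, `r`, `P` enter the bounds for `‖l‖` and `‖m‖`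
  -- below.
  let N := 1 + ‖C‖ * ‖T‖ + ‖G‖ + ‖e‖ * ‖G‖
  have hN : 0 < N := by positivity
  refine ⟨2 / (min c₁ c₂ / K) * N, by positivity, fun r P b q => ?_⟩
  -- The terms with the data `r` and `P` are moved to the right-hand side, leaving a system that is
  -- homogeneous in `(u, φ)` on the left.
  let l : StrongDual ℝ X := b + innerSL ℝ (C r) ∘L T
  let m : StrongDual ℝ Y := q + innerSL ℝ (P - e r) ∘L G
  have hiff : ∀ U : X × Y, ((∀ v, ⟪C (T U.1 - r), T v⟫_ℝ + ⟪G U.2, e (T v)⟫_ℝ = b v) ∧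
      ∀ ψ, -⟪e (T U.1 - r) - M (G U.2) + P, G ψ⟫_ℝ = q ψ) ↔
      (∀ v, ⟪C (T U.1), T v⟫_ℝ + ⟪G U.2, e (T v)⟫_ℝ = l v) ∧
        ∀ ψ, ⟪M (G U.2), G ψ⟫_ℝ - ⟪e (T U.1), G ψ⟫_ℝ = m ψ := by
    intro U
    have hl : ∀ v, l v = b v + ⟪C r, T v⟫_ℝ := fun _ => rfl
    have hm : ∀ ψ, m ψ = q ψ + ⟪P - e r, G ψ⟫_ℝ := fun _ => rfl
    refine and_congr (forall_congr' fun v => ?_) (forall_congr' fun ψ => ?_)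
    · rw [map_sub, inner_sub_left, hl]
      constructor <;> intro h <;> linarith
    · rw [map_sub, inner_add_left, inner_sub_left, inner_sub_left, hm, inner_sub_left]
      constructor <;> intro h <;> linarith
  simp only [hiff]
  refine ⟨exists_unique_skewCoupled T G C M e hc hCT hMG l m, fun U hU => ?_⟩
  refine (norm_le_of_skewCoupled T G C M e hc hCT hMG l m (hU.1 U.1) (hU.2 U.2)).trans ?_
  rw [mul_assoc]
  refine mul_le_mul_of_nonneg_left ?_ (by positivity)
  have h1 : ‖l‖ ≤ ‖b‖ + ‖C‖ * ‖r‖ * ‖T‖ := by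
    refine (norm_add_le _ _).trans (add_le_add le_rfl ?_)
    refine (ContinuousLinearMap.opNorm_comp_le _ _).trans ?_
    rw [innerSL_apply_norm]
    exact mul_le_mul_of_nonneg_right (C.le_opNorm r) (norm_nonneg _)
  have h2 : ‖m‖ ≤ ‖q‖ + (‖P‖ + ‖e‖ * ‖r‖) * ‖G‖ := by
    refine (norm_add_le _ _).trans (add_le_add le_rfl ?_)
    refine (ContinuousLinearMap.opNorm_comp_le _ _).trans ?_
    rw [innerSL_apply_norm]
    exact mul_le_mul_of_nonneg_right
      ((norm_sub_le _ _).trans (add_le_add le_rfl (e.le_opNorm r))) (norm_nonneg _)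
  have key : N * (‖r‖ + ‖P‖ + ‖b‖ + ‖q‖)
      = (‖b‖ + ‖C‖ * ‖r‖ * ‖T‖) + (‖q‖ + (‖P‖ + ‖e‖ * ‖r‖) * ‖G‖)
        + (‖r‖ + ‖P‖ + ‖C‖ * ‖T‖ * (‖P‖ + ‖b‖ + ‖q‖) + ‖G‖ * (‖r‖ + ‖b‖ + ‖q‖)
          + ‖e‖ * ‖G‖ * (‖P‖ + ‖b‖ + ‖q‖)) := by
    simp only [N]
    ring
  rw [key]
  have : 0 ≤ ‖r‖ + ‖P‖ + ‖C‖ * ‖T‖ * (‖P‖ + ‖b‖ + ‖q‖) + ‖G‖ * (‖r‖ + ‖b‖ + ‖q‖)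
      + ‖e‖ * ‖G‖ * (‖P‖ + ‖b‖ + ‖q‖) := by positivity
  linarith

/-- The same well-posedness on nested subspaces of Hilbert spaces. -/
theorem skewCoupled_wellPosed_submodule {A B : Type*} [NormedAddCommGroup A]
    [InnerProductSpace ℝ A] [NormedAddCommGroup B] [InnerProductSpace ℝ B] {p : Submodule ℝ A} (p₀ : Submodule ℝ p)
    {q : Submodule ℝ B} (q₀ : Submodule ℝ q) [CompleteSpace p₀] [CompleteSpace q₀]
    (T : p →L[ℝ] S) (G : q →L[ℝ] E) (C : S →L[ℝ] S) (M : E →L[ℝ] E) (e : S →L[ℝ] E)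
    {K c₁ c₂ : ℝ} (hK : 0 < K) (hc₁ : 0 < c₁) (hc₂ : 0 < c₂)
    (hT : ∀ u : p₀, ‖u‖ ^ 2 ≤ K * ‖T u.1‖ ^ 2) (hG : ∀ φ : q₀, ‖φ‖ ^ 2 ≤ K * ‖G φ.1‖ ^ 2)
    (hC : ∀ s, c₁ * ‖s‖ ^ 2 ≤ ⟪C s, s⟫_ℝ) (hM : ∀ s, c₂ * ‖s‖ ^ 2 ≤ ⟪M s, s⟫_ℝ) :
    ∃ c : ℝ, 0 < c ∧ ∀ (r : S) (P : E) (b : StrongDual ℝ p₀) (d : StrongDual ℝ q₀),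
      (∃! U : p₀ × q₀, (∀ v : p₀, ⟪C (T U.1.1 - r), T v.1⟫_ℝ + ⟪G U.2.1, e (T v.1)⟫_ℝ = b v) ∧
        ∀ ψ : q₀, -⟪e (T U.1.1 - r) - M (G U.2.1) + P, G ψ.1⟫_ℝ = d ψ) ∧
      ∀ U : p₀ × q₀, ((∀ v : p₀, ⟪C (T U.1.1 - r), T v.1⟫_ℝ + ⟪G U.2.1, e (T v.1)⟫_ℝ = b v) ∧
        ∀ ψ : q₀, -⟪e (T U.1.1 - r) - M (G U.2.1) + P, G ψ.1⟫_ℝ = d ψ) →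
          ‖U.1‖ + ‖U.2‖ ≤ c * (‖r‖ + ‖P‖ + ‖b‖ + ‖d‖) := by
  let T' : p₀ →L[ℝ] S := T ∘L p₀.subtypeL
  let G' : q₀ →L[ℝ] E := G ∘L q₀.subtypeL
  exact skewCoupled_wellPosed (X := p₀) (Y := q₀) T' G' C M e hK hc₁ hc₂ hT hG hC hM

end SkewCoupled

/-! ### The piezoelectric system as an instance of the abstract one. -/

namespace Piezo

variable {Ω : TopologicalSpace.Opens E3}

/-- Both the strain and the gradient are bounded below on `W^{1,2}_0` of a bounded open set. -/
lemma exists_norm_sq_le (hbdd : Bornology.IsBounded (Ω : Set E3)) :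
    ∃ K : ℝ, 0 < K ∧ (∀ u : W012 Ω E3, ‖u‖ ^ 2 ≤ K * ‖strainCLM u.1‖ ^ 2) ∧
      ∀ φ : W012 Ω ℝ, ‖φ‖ ^ 2 ≤ K * ‖gradCLM φ.1‖ ^ 2 := by
  obtain ⟨R, hR⟩ := hbdd.exists_norm_le
  -- Poincaré contributes `4 R² + 1` and Korn the factor `2`, which the gradient does not need.
  refine ⟨2 * (4 * R ^ 2 + 1), by positivity, fun u => ?_, fun φ => ?_⟩
  · have h1 := norm_sq_le_sum_wderiv u hR
    have h2 := mul_le_mul_of_nonneg_left (sum_norm_sq_wderiv_le_strainCLM u)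
      (by positivity : 0 ≤ 4 * R ^ 2 + 1)
    linarith
  · have h1 := norm_sq_le_sum_wderiv φ hR
    have h2 : ‖gradCLM φ.1‖ ^ 2 = ∑ k, ‖wderiv φ k‖ ^ 2 := norm_sq_gradCLM φ.1
    rw [← h2] at h1
    nlinarith [mul_nonneg (by positivity : 0 ≤ 4 * R ^ 2 + 1) (sq_nonneg ‖gradCLM φ.1‖)]

section Operators

variable {F F' V W : Type} [NormedAddCommGroup F] [InnerProductSpace ℝ F]
  [NormedAddCommGroup F'] [InnerProductSpace ℝ F']
  [NormedAddCommGroup V] [InnerProductSpace ℝ V] [NormedAddCommGroup W] [InnerProductSpace ℝ W]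

/-- The weak form of the piezoelectric equations in terms of operators between `L²` spaces. -/
def IsOpSolution (T : SobolevOp Ω F V) (G : SobolevOp Ω F' W) (C : L2Op Ω V V) (M : L2Op Ω W W)
    (e : L2Op Ω V W) (r : L2 Ω V) (P : L2 Ω W) (b : Wm12 Ω F) (q : Wm12 Ω F')
    (U : W012 Ω F × W012 Ω F') : Prop :=
  (∀ v : W012 Ω F, ⟪C (T U.1.1 - r), T v.1⟫_ℝ + ⟪G U.2.1, e (T v.1)⟫_ℝ = b v) ∧
    ∀ ψ : W012 Ω F', -⟪e (T U.1.1 - r) - M (G U.2.1) + P, G ψ.1⟫_ℝ = q ψ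

theorem isOpSolution_wellPosed [CompleteSpace F] [CompleteSpace F'] (T : SobolevOp Ω F V)
    (G : SobolevOp Ω F' W) (C : L2Op Ω V V) (M : L2Op Ω W W) (e : L2Op Ω V W) {K c₁ c₂ : ℝ}
    (hK : 0 < K) (hc₁ : 0 < c₁) (hc₂ : 0 < c₂)
    (hT : ∀ u : W012 Ω F, ‖u‖ ^ 2 ≤ K * ‖T u.1‖ ^ 2)
    (hG : ∀ φ : W012 Ω F', ‖φ‖ ^ 2 ≤ K * ‖G φ.1‖ ^ 2)
    (hC : ∀ s, c₁ * ‖s‖ ^ 2 ≤ ⟪C s, s⟫_ℝ) (hM : ∀ s, c₂ * ‖s‖ ^ 2 ≤ ⟪M s, s⟫_ℝ) :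
    ∃ c : ℝ, 0 < c ∧ ∀ (r : L2 Ω V) (P : L2 Ω W) (b : Wm12 Ω F) (q : Wm12 Ω F'),
      (∃! U : W012 Ω F × W012 Ω F', IsOpSolution T G C M e r P b q U) ∧
      ∀ U : W012 Ω F × W012 Ω F', IsOpSolution T G C M e r P b q U →
          ‖U.1‖ + ‖U.2‖ ≤ c * (‖r‖ + ‖P‖ + ‖b‖ + ‖q‖) :=
  skewCoupled_wellPosed_submodule (A := Jet Ω F) (B := Jet Ω F') (p := W12 Ω F) (q := W12 Ω F')
    (W012 Ω F) (W012 Ω F') T G C M e hK hc₁ hc₂ hT hG hC hM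

end Operators

variable {C : E3 → S3 →L[ℝ] S3} {ϵ : E3 → E3 →L[ℝ] E3} {e : E3 → S3 →L[ℝ] E3}

lemma integral_inner_eq_inner {V : Type} [NormedAddCommGroup V] [InnerProductSpace ℝ V]
    {a b : L2 Ω V} {f g : E3 → V} (ha : a =ᵐ[vol Ω] f) (hb : b =ᵐ[vol Ω] g) :
    ∫ x in (Ω : Set E3), ⟪f x, g x⟫_ℝ = ⟪a, b⟫_ℝ := by
  rw [L2.inner_def]
  refine integral_congr_ae ?_
  filter_upwards [ha, hb] with x hx hy
  rw [hx, hy]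

/-- The transpose of `e` is moved onto the test strain, and `E = -∇φ` turns the minus sign of the
coupling into a plus. This is where the skew structure becomes visible. -/
lemma integral_inner_stress (hC : MemLp C ∞ (vol Ω)) (he : MemLp e ∞ (vol Ω)) (r : L2 Ω S3)
    (u v : W012 Ω E3) (φ : W012 Ω ℝ) :
    ∫ x in (Ω : Set E3), ⟪stress C e r u φ x, strain v x⟫_ℝ =
      ⟪applyCLM hC (strainCLM u.1 - r), strainCLM v.1⟫_ℝ
        + ⟪gradCLM φ.1, applyCLM he (strainCLM v.1)⟫_ℝ := by
  rw [L2.inner_def, L2.inner_def, ← integral_add (L2.integrable_inner _ _)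
    (L2.integrable_inner _ _)]
  refine integral_congr_ae ?_
  filter_upwards [strainCLM_ae_eq u, strainCLM_ae_eq v, gradCLM_ae_eq φ,
    applyCLM_ae_eq hC (strainCLM u.1 - r), applyCLM_ae_eq he (strainCLM v.1),
    Lp.coeFn_sub (strainCLM u.1) r] with x h1 h2 h3 h4 h5 h6
  rw [h4, h5, h6, Pi.sub_apply, h1, h2, h3, stress, inner_sub_left,
    ContinuousLinearMap.adjoint_inner_left, electricField, inner_neg_left, sub_neg_eq_add]

lemma integral_inner_displacement (hϵ : MemLp ϵ ∞ (vol Ω)) (he : MemLp e ∞ (vol Ω)) (r : L2 Ω S3)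
    (P : L2 Ω E3) (u : W012 Ω E3) (φ ψ : W012 Ω ℝ) :
    ∫ x in (Ω : Set E3), ⟪displacement ϵ e r P u φ x, grad ψ x⟫_ℝ =
      ⟪applyCLM he (strainCLM u.1 - r) - applyCLM hϵ (gradCLM φ.1) + P, gradCLM ψ.1⟫_ℝ := by
  refine integral_inner_eq_inner ?_ (gradCLM_ae_eq ψ)
  filter_upwards [strainCLM_ae_eq u, gradCLM_ae_eq φ,
    applyCLM_ae_eq he (strainCLM u.1 - r), applyCLM_ae_eq hϵ (gradCLM φ.1),
    Lp.coeFn_sub (strainCLM u.1) r,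
    Lp.coeFn_sub (applyCLM he (strainCLM u.1 - r)) (applyCLM hϵ (gradCLM φ.1)),
    Lp.coeFn_add (applyCLM he (strainCLM u.1 - r) - applyCLM hϵ (gradCLM φ.1)) P]
    with x h1 h2 h3 h4 h5 h6 h7
  rw [h7, Pi.add_apply, h6, Pi.sub_apply, h3, h4, h5, Pi.sub_apply, h1, h2, displacement,
    electricField, map_neg, sub_eq_add_neg]

lemma isWeakSolution_iff (hC : MemLp C ∞ (vol Ω)) (hϵ : MemLp ϵ ∞ (vol Ω))
    (he : MemLp e ∞ (vol Ω)) (r : L2 Ω S3) (P : L2 Ω E3) (b : Wm12 Ω E3) (q : Wm12 Ω ℝ)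
    (U : W012 Ω E3 × W012 Ω ℝ) :
    IsWeakSolution C ϵ e r P b q U ↔
      IsOpSolution strainCLM gradCLM (applyCLM hC) (applyCLM hϵ) (applyCLM he) r P b q U := by
  unfold IsWeakSolution IsOpSolution
  simp only [integral_inner_stress hC he, integral_inner_displacement hϵ he]

end Piezo

end

theorem theorem3p1 (Ω : TopologicalSpace.Opens Piezo.E3)
    (hbdd : Bornology.IsBounded (Ω : Set Piezo.E3)) (hC1 : Piezo.HasC1Boundary Ω)
    (C : Piezo.E3 → Piezo.S3 →L[ℝ] Piezo.S3)
    (ϵ : Piezo.E3 → Piezo.E3 →L[ℝ] Piezo.E3)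
    (e : Piezo.E3 → Piezo.S3 →L[ℝ] Piezo.E3)
    -- the coefficients are measurable and (essentially) bounded on `Ω`
    (hC : MemLp C ∞ (Piezo.vol Ω)) (hϵ : MemLp ϵ ∞ (Piezo.vol Ω))
    (he : MemLp e ∞ (Piezo.vol Ω))
    (hCpos : Piezo.SymmUniformlyPosDef Ω C) (hϵpos : Piezo.SymmUniformlyPosDef Ω ϵ) :
    ∃ c : ℝ, 0 < c ∧
      ∀ (r : Piezo.L2 Ω Piezo.S3) (P : Piezo.L2 Ω Piezo.E3)
        (b : Piezo.Wm12 Ω Piezo.E3) (q : Piezo.Wm12 Ω ℝ),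
        (∃! U : Piezo.W012 Ω Piezo.E3 × Piezo.W012 Ω ℝ,
          Piezo.IsWeakSolution C ϵ e r P b q U) ∧
        ∀ U : Piezo.W012 Ω Piezo.E3 × Piezo.W012 Ω ℝ,
          Piezo.IsWeakSolution C ϵ e r P b q U →
            ‖U.1‖ + ‖U.2‖ ≤ c * (‖r‖ + ‖P‖ + ‖b‖ + ‖q‖) := by
  open Piezo in
  obtain ⟨-, c₁, hc₁, hC'⟩ := hCpos
  obtain ⟨-, c₂, hc₂, hϵ'⟩ := hϵpos
  obtain ⟨K, hK, hKu, hKφ⟩ := exists_norm_sq_le hbdd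
  simp only [isWeakSolution_iff hC hϵ he]
  exact isOpSolution_wellPosed strainCLM gradCLM (applyCLM hC) (applyCLM hϵ) (applyCLM he)
    hK hc₁ hc₂ hKu hKφ (le_inner_applyCLM hC hC') (le_inner_applyCLM hϵ hϵ')
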